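/- Let $Q$ be a commutative unital quantale (a complete lattice with a commutative monoid structure $(\cdot,1)$ whose multiplication preserves arbitrary joins in each argument), with residuum $p\to q=\bigvee\{r\in Q\mid p\cdot r\le q\}$, and let $\Omega$ be a set of function symbols, each with a finite arity $n\in\mathbb N_0$. A $Q$-order on a set $X$ is a map $e\colon X\times X\to Q$ such that $1\le e(x,x)$; $e(x,y)\cdot e(y,z)\le e(x,z)$; and $x=y$ whenever $1\le e(x,y)$ and $1\le e(y,x)$. A $Q$-join $\bigsqcup M$ of a map $M\colon X\to Q$ is an element $s\in X$ with $M(x)\le e(x,s)$ for all $x\in X$ and $\bigwedge_{x\in X}\bigl(M(x)\to e(x,y)\bigr)\le e(s,y)$ for all $y\in X$. A $Q$-sup-lattice is a set with a $Q$-order for which every $M\in Q^X$ has a $Q$-join. For a map $f\colon X\to Y$ and $M\in Q^X$ put $f_Q^{\to}(M)(y)=\bigvee_{x\in f^{-1}(y)}M(x)$. The map $f$ between $Q$-ordered sets is $Q$-join-preserving if, whenever $\bigsqcup M$ exists, $\bigsqcup f_Q^{\to}(M)$ exists and $f(\bigsqcup M)=\bigsqcup f_Q^{\to}(M)$. A $Q$-sup-algebra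 of type $\Omega$ is a $Q$-sup-lattice $A$ with an operation $\omega_A\colon A^n\to A$ for each $n$-ary $\omega\in\Omega$ that is $Q$-join-preserving in each argument separately. A homomorphism is a $Q$-join-preserving map that commutes with all operations (including the nullary ones). Let $Q\text{-}\mathbf{Sup}\text{-}\Omega\text{-}\mathbf{Alg}$ be the resulting category. Then the category $Q\text{-}\mathbf{Sup}\text{-}\Omega\text{-}\mathbf{Alg}$ 1. is complete (has all small limits); 2. is cocomplete (has all small colimits); 3. is wellpowered (the subobjects of each object form a set, up to isomorphism); 4. is extremally co-wellpowered (for each object $A$, the extremal epimorphisms with domain $A$ form a set, up to isomorphism under $A$; an epimorphism $e$ is extremal if $e=m\circ f$ with $m$ a monomorphism implies that $m$ is an isomorphism); 5. has regular factorizations, i.e. it is a (RegEpi, Mono-Source)-category. Here a source is a family $(f_i\colon A\to B_i)_{i\in I}$ indexed by an arbitrary, possibly empty, class $I$, and it is a mono-source if any two morphisms $g,h$ into $A$ with $f_i\circ g=f_i\circ h$ for all $i\in I$ are equal. The requirements are: regular epimorphisms and mono-sources are closed under composition with isomorphisms; every source $(f_i)_{i\in I}$ factors as $f_i=m_i\circ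 e$ with $e$ a regular epimorphism and $(m_i)_{i\in I}$ a mono-source; and whenever $m_i\circ f=g_i\circ e$ for all $i\in I$, with $e$ a regular epimorphism and $(m_i)_{i\in I}$ a mono-source, there is a unique morphism $d$ with $d\circ e=f$ and $m_i\circ d=g_i$ for all $i\in I$. Moreover, a morphism of $Q\text{-}\mathbf{Sup}\text{-}\Omega\text{-}\mathbf{Alg}$ is a monomorphism if and only if it is an injective function. -/

import Mathlib

open CategoryTheory CategoryTheory.Limits Opposite
open scoped Quantale

universe w v u

section QOrder

variable {Q : Type u} [CommMonoid Q] [CompleteLattice Q] [IsQuantale Q]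

/-- `e : X → X → Q` is a `Q`-order on `X`. -/
structure IsQOrder {X : Type v} (e : X → X → Q) : Prop where
  one_le_refl : ∀ x, 1 ≤ e x x
  trans : ∀ x y z, e x y * e y z ≤ e x z
  antisymm : ∀ x y, 1 ≤ e x y → 1 ≤ e y x → x = y

/-- `s` is a `Q`-join of the `Q`-subset `M` of `(X, e)`. -/
structure IsQJoin {X : Type v} (e : X → X → Q) (M : X → Q) (s : X) : Prop where
  le : ∀ x, M x ≤ e x s
  least : ∀ y, (⨅ x, (M x ⇨ᵣ e x y)) ≤ e s y

/-- Zadeh's forward power set operator: `(f_Q^→ M)(y)` is the join of `M x` over `x ∈ f⁻¹(y)`. -/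
def zadehForward {X : Type v} {Y : Type w} (f : X → Y) (M : X → Q) : Y → Q :=
  fun y => ⨆ x ∈ f ⁻¹' {y}, M x

/-- `f` is `Q`-join-preserving: whenever `s` is a `Q`-join of `M`, the image `f s` is a `Q`-join
of the forward image of `M`. -/
def IsQJoinPreserving {X : Type v} {Y : Type w} (eX : X → X → Q) (eY : Y → Y → Q)
    (f : X → Y) : Prop :=
  ∀ (M : X → Q) (s : X), IsQJoin eX M s → IsQJoin eY (zadehForward f M) (f s)

end QOrder

/-- A `Q`-sup-algebra of the type consisting of the set `Ω` of function symbols with arities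
`ar`. -/
structure QSupAlg (Q : Type u) [CommMonoid Q] [CompleteLattice Q] [IsQuantale Q]
    {Ω : Type u} (ar : Ω → ℕ) where
  carrier : Type u
  /-- the `Q`-order -/
  e : carrier → carrier → Q
  isQOrder : IsQOrder e
  exists_isQJoin : ∀ M : carrier → Q, ∃ s, IsQJoin e M s
  /-- the operations -/
  op : ∀ ω : Ω, (Fin (ar ω) → carrier) → carrier
  op_preserving : ∀ (ω : Ω) (j : Fin (ar ω)) (a : Fin (ar ω) → carrier),
    IsQJoinPreserving e e (fun x => op ω (Function.update a j x))

namespace QSupAlg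

theorem zadehForward_id {Q : Type u} [CompleteLattice Q] {X : Type v} (M : X → Q) :
    zadehForward (fun x : X => x) M = M := by
  funext y
  simp [zadehForward]

theorem zadehForward_comp {Q : Type u} [CompleteLattice Q] {X Y Z : Type v}
    (f : X → Y) (g : Y → Z) (M : X → Q) :
    zadehForward (fun x => g (f x)) M = zadehForward g (zadehForward f M) := by
  funext z
  apply le_antisymm
  · refine iSup₂_le fun x hx => ?_
    exact le_iSup₂_of_le (f x) hx (le_iSup₂_of_le x rfl le_rfl)
  · refine iSup₂_le fun y hy => iSup₂_le fun x hx => ?_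
    have hxy : f x = y := hx
    subst hxy
    exact le_iSup₂_of_le x hy le_rfl

variable {Q : Type u} [CommMonoid Q] [CompleteLattice Q] [IsQuantale Q] {Ω : Type u} {ar : Ω → ℕ}

/-- Homomorphisms of `Q`-sup-algebras. -/
@[ext]
structure Hom (A B : QSupAlg Q ar) where
  toFun : A.carrier → B.carrier
  preserving : IsQJoinPreserving A.e B.e toFun
  map_op : ∀ (ω : Ω) (a : Fin (ar ω) → A.carrier), B.op ω (fun i => toFun (a i)) = toFun (A.op ω a)

/-- The category of `Q`-sup-algebras of a given type, with their homomorphisms. -/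
instance category : Category.{u} (QSupAlg Q ar) where
  Hom A B := Hom A B
  id A :=
    { toFun := fun x => x
      preserving := fun M s hs => by rw [zadehForward_id]; exact hs
      map_op := fun _ _ => rfl }
  comp f g :=
    { toFun := fun x => g.toFun (f.toFun x)
      preserving := fun M s hs => by
        rw [zadehForward_comp]
        exact g.preserving _ _ (f.preserving _ _ hs)
      map_op := fun ω a => by rw [g.map_op, f.map_op] }

end QSupAlg

section CategoryNotions

/-- A category is extremally co-wellpowered if every object has only a set of extremal quotients,
that is, of extremal epimorphisms out of it up to isomorphism. A quotient object of `X` is a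
subobject of `X` in the opposite category. -/
def ExtremallyCoWellPowered (C : Type v) [Category.{u} C] : Prop :=
  ∀ X : C, Small.{u} {S : Subobject (op X) // ExtremalEpi S.arrow.unop}

variable {C : Type v} [Category.{u} C]

/-- A source `(m i : A ⟶ B i)`, indexed by an arbitrary (possibly empty) class `I`, is a
mono-source. -/
def IsMonoSource {I : Type w} {A : C} {B : I → C} (m : ∀ i, A ⟶ B i) : Prop :=
  ∀ ⦃Z : C⦄ (g h : Z ⟶ A), (∀ i, g ≫ m i = h ≫ m i) → g = h

/-- A category has regular factorizations if it is a (RegEpi, Mono-Source)-category: regular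
epimorphisms and mono-sources are closed under composition with isomorphisms, every source is a
regular epimorphism followed by a mono-source, and the unique diagonalization property holds. -/
structure HasRegularFactorizations (C : Type v) [Category.{u} C] : Prop where
  regularEpi_comp_iso : ∀ {A B B' : C} (e : A ⟶ B) (h : B ≅ B'),
    IsRegularEpi e → IsRegularEpi (e ≫ h.hom)
  iso_comp_monoSource : ∀ {I : Type w} {A A' : C} {B : I → C} (h : A' ≅ A) (m : ∀ i, A ⟶ B i),
    IsMonoSource m → IsMonoSource (fun i => h.hom ≫ m i)
  factorization : ∀ {I : Type w} {A : C} {B : I → C} (f : ∀ i, A ⟶ B i),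
    ∃ (E : C) (e : A ⟶ E) (m : ∀ i, E ⟶ B i),
      IsRegularEpi e ∧ IsMonoSource m ∧ ∀ i, e ≫ m i = f i
  diagonalization : ∀ {I : Type w} {A B D : C} {E : I → C} (e : A ⟶ B) (m : ∀ i, D ⟶ E i)
    (f : A ⟶ D) (g : ∀ i, B ⟶ E i), IsRegularEpi e → IsMonoSource m →
    (∀ i, e ≫ g i = f ≫ m i) → ∃! d : B ⟶ D, e ≫ d = f ∧ ∀ i, d ≫ m i = g i

end CategoryNotions

/-! By residuation, the two join axioms together say that `q ≤ e s y` iff `M x * q ≤ e x y` for all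
`x`. In this form (`IsWeightedJoin`) joins can be taken over any indexed family, are unique, and are
carried along by join-preserving maps.

A jointly injective family of maps into algebras, along which joins and operations lift, induces an
algebra whose order is the infimum of the pulled-back orders (`initialStructure`). Limits, kernel
pairs and images of sources all arise in this way. Kernel pairs show that mono-sources are the
jointly injective sources and, since surjections are final (`exists_comp_eq_of_surjective`), that
regular epimorphisms are the surjections. Regular factorizations follow; subobjects are determined
by their ranges, extremal quotients by their kernels.

Colimits use the free algebra of `Q`-valued functions on terms. Every cocone induces a map out of
the free algebra on the disjoint union of the diagram; factoring the source of all these maps gives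
the colimit. The source is indexed by a class, but its image is a quotient of one algebra, hence
small. -/

/-! ### Weighted joins -/

section WeightedJoin

variable {Q : Type u} [CommMonoid Q] [CompleteLattice Q]

/-- `t` is the join of the family `g` weighted by `M`. For an indexing by the identity this is a
`Q`-join, see `isQJoin_iff`; in general it is a `Q`-join of a forward image, see
`isQJoin_zadehForward_iff`. -/
def IsWeightedJoin {ι : Type w} {X : Type v} (e : X → X → Q) (M : ι → Q) (g : ι → X) (t : X) :
    Prop :=
  ∀ (y : X) (q : Q), q ≤ e t y ↔ ∀ i, M i * q ≤ e (g i) y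

theorem IsWeightedJoin.unique {ι : Type w} {X : Type v} {e : X → X → Q} (he : IsQOrder e)
    {M : ι → Q} {g : ι → X} {s t : X} (hs : IsWeightedJoin e M g s)
    (ht : IsWeightedJoin e M g t) : s = t :=
  he.antisymm _ _ ((hs _ _).2 ((ht _ _).1 (he.one_le_refl t)))
    ((ht _ _).2 ((hs _ _).1 (he.one_le_refl s)))

variable [IsQuantale Q]

theorem zadehForward_mul_le_iff {ι : Type w} {X : Type v} (g : ι → X) (M : ι → Q) (q : Q)
    (φ : X → Q) : (∀ x, zadehForward g M x * q ≤ φ x) ↔ ∀ i, M i * q ≤ φ (g i) := by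
  simp only [zadehForward, Quantale.iSup_mul_distrib, iSup_le_iff, Set.mem_preimage,
    Set.mem_singleton_iff]
  constructor
  · intro h i
    exact (mul_le_mul_left (le_iSup (fun _ : g i = g i => M i) rfl) q).trans (h _ i)
  · intro h x i
    by_cases hi : g i = x
    · subst hi
      simpa using h i
    · simp [hi]

/-- Transitivity and residuation give the forward direction; conversely, `y = s`, `q = 1` gives the
upper bound, and `q` the infimum of the residua gives leastness. -/
theorem isQJoin_iff {X : Type v} {e : X → X → Q} (he : IsQOrder e) (M : X → Q) (s : X) :
    IsQJoin e M s ↔ IsWeightedJoin e M id s := by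
  constructor
  · intro h y q
    constructor
    · intro hq x
      exact (mul_le_mul' (h.le x) hq).trans (he.trans _ _ _)
    · intro hq
      exact (le_iInf fun x => Quantale.rightMulResiduation_le_iff_mul_le.2 (hq x)).trans (h.least y)
  · intro h
    refine ⟨fun x => ?_, fun y => ?_⟩
    · simpa using (h s 1).1 (he.one_le_refl s) x
    · exact (h y _).2 fun x => Quantale.rightMulResiduation_le_iff_mul_le.1 (iInf_le _ x)

theorem isQJoin_zadehForward_iff {ι : Type w} {X : Type v} {e : X → X → Q} (he : IsQOrder e)
    (M : ι → Q) (g : ι → X) (s : X) :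
    IsQJoin e (zadehForward g M) s ↔ IsWeightedJoin e M g s := by
  rw [isQJoin_iff he]
  exact forall₂_congr fun y q => iff_congr Iff.rfl
    (zadehForward_mul_le_iff g M q fun x => e x y)

theorem IsQJoinPreserving.isWeightedJoin {ι : Type*} {X : Type v} {Y : Type w}
    {eX : X → X → Q} {eY : Y → Y → Q} (hX : IsQOrder eX) (hY : IsQOrder eY) {f : X → Y}
    (hf : IsQJoinPreserving eX eY f) {M : ι → Q} {g : ι → X} {s : X}
    (hs : IsWeightedJoin eX M g s) : IsWeightedJoin eY M (fun i => f (g i)) (f s) := by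
  have h := hf _ _ ((isQJoin_zadehForward_iff hX M g s).2 hs)
  rw [isQJoin_zadehForward_iff hY] at h
  exact fun y q => (h y q).trans (zadehForward_mul_le_iff g M q fun x => eY (f x) y)

theorem isQJoinPreserving_iff {X : Type v} {Y : Type w}
    {eX : X → X → Q} {eY : Y → Y → Q} (hX : IsQOrder eX) (hY : IsQOrder eY) {f : X → Y} :
    IsQJoinPreserving eX eY f ↔
      ∀ (M : X → Q) (s : X), IsWeightedJoin eX M id s → IsWeightedJoin eY M f (f s) := by
  simp only [IsQJoinPreserving, isQJoin_iff hX, isQJoin_zadehForward_iff hY]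

end WeightedJoin

/-! ### Homomorphisms and their lifting along injective sources and surjections -/

namespace QSupAlg

variable {Q : Type u} [CommMonoid Q] [CompleteLattice Q] [IsQuantale Q] {Ω : Type u} {ar : Ω → ℕ}

theorem exists_isWeightedJoin (A : QSupAlg Q ar) {ι : Type w} (M : ι → Q) (g : ι → A.carrier) :
    ∃ s, IsWeightedJoin A.e M g s := by
  obtain ⟨s, hs⟩ := A.exists_isQJoin (zadehForward g M)
  exact ⟨s, (isQJoin_zadehForward_iff A.isQOrder M g s).1 hs⟩

theorem Hom.isWeightedJoin {A B : QSupAlg Q ar} (f : A ⟶ B) {ι : Type w} {M : ι → Q}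
    {g : ι → A.carrier} {s : A.carrier} (hs : IsWeightedJoin A.e M g s) :
    IsWeightedJoin B.e M (fun i => f.toFun (g i)) (f.toFun s) :=
  f.preserving.isWeightedJoin A.isQOrder B.isQOrder hs

theorem op_isWeightedJoin (A : QSupAlg Q ar) (ω : Ω) (j : Fin (ar ω))
    (a : Fin (ar ω) → A.carrier) {ι : Type w} {M : ι → Q}
    {g : ι → A.carrier} {s : A.carrier} (hs : IsWeightedJoin A.e M g s) :
    IsWeightedJoin A.e M (fun i => A.op ω (Function.update a j (g i)))
      (A.op ω (Function.update a j s)) :=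
  (A.op_preserving ω j a).isWeightedJoin A.isQOrder A.isQOrder hs

theorem hom_ext {A B : QSupAlg Q ar} {f g : A ⟶ B} (h : ∀ x, f.toFun x = g.toFun x) : f = g :=
  Hom.ext (funext h)

theorem toFun_congr {A B : QSupAlg Q ar} {f g : A ⟶ B} (h : f = g) (x : A.carrier) :
    f.toFun x = g.toFun x := by rw [h]

theorem comp_toFun {A B C : QSupAlg Q ar} (f : A ⟶ B) (g : B ⟶ C) (x : A.carrier) :
    (f ≫ g).toFun x = g.toFun (f.toFun x) := rfl

/-- A family of maps is jointly injective. -/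
def JointlyInjective {I : Type w} {X : Type v} {Y : I → Type*} (m : ∀ i, X → Y i) : Prop :=
  ∀ x y, (∀ i, m i x = m i y) → x = y

/-- A map into `A` is a homomorphism if its composites with a jointly injective family of
homomorphisms are. -/
def homOfComp {I : Type w} {A Z : QSupAlg Q ar} {B : I → QSupAlg Q ar} (m : ∀ i, A ⟶ B i)
    (hm : JointlyInjective fun i => (m i).toFun) (d : Z.carrier → A.carrier) (k : ∀ i, Z ⟶ B i)
    (hk : ∀ i z, (m i).toFun (d z) = (k i).toFun z) : Z ⟶ A where
  toFun := d
  preserving := by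
    rw [isQJoinPreserving_iff Z.isQOrder A.isQOrder]
    intro M s hs
    obtain ⟨t, ht⟩ := A.exists_isWeightedJoin M d
    -- Both sides have the same image under each `m i`, namely the join of the family `k i` weighted
    -- by `M`.
    have : d s = t := by
      refine hm _ _ fun i => ?_
      have h1 := Hom.isWeightedJoin (m i) ht
      have h2 := Hom.isWeightedJoin (k i) hs
      simp only [hk] at h1 ⊢
      exact h2.unique (B i).isQOrder h1
    exact this ▸ ht
  map_op ω a := by
    refine hm _ _ fun i => ?_
    beta_reduce
    rw [← (m i).map_op, hk, ← (k i).map_op]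
    simp only [hk]

/-- A surjective homomorphism `e` is final: every homomorphism whose kernel contains that of `e`
factors through `e`. -/
theorem exists_comp_eq_of_surjective {A B D : QSupAlg Q ar} (e : A ⟶ B)
    (he : Function.Surjective e.toFun) (f : A ⟶ D)
    (h : ∀ x y, e.toFun x = e.toFun y → f.toFun x = f.toFun y) : ∃ d : B ⟶ D, e ≫ d = f := by
  let d : B.carrier → D.carrier := fun b => f.toFun (Function.surjInv he b)
  have hd : ∀ a, d (e.toFun a) = f.toFun a := fun a => h _ _ (Function.surjInv_eq he _)
  refine ⟨⟨d, ?_, ?_⟩, hom_ext hd⟩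
  · rw [isQJoinPreserving_iff B.isQOrder D.isQOrder]
    intro M s hs
    -- Pull the weights back to `A`, where a join exists; by surjectivity its image is the join of
    -- `M`.
    obtain ⟨t, ht⟩ := A.exists_isWeightedJoin (fun a => M (e.toFun a)) id
    have h1 := Hom.isWeightedJoin e ht
    have h2 := Hom.isWeightedJoin f ht
    have h3 : s = e.toFun t :=
      hs.unique B.isQOrder fun y q => (h1 y q).trans
        (he.forall (p := fun b => M b * q ≤ B.e b y)).symm
    intro y q
    rw [he.forall, h3, hd, h2]
    simp only [hd, id]
  · intro ω b
    obtain ⟨a, rfl⟩ : ∃ a : Fin (ar ω) → A.carrier, (fun i => e.toFun (a i)) = b :=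
      ⟨fun i => Function.surjInv he (b i), funext fun i => Function.surjInv_eq he _⟩
    rw [e.map_op, hd, ← f.map_op]
    simp only [hd]

/-! ### Initial structures -/

section InitialStructure

variable {I : Type w} {X : Type u} {B : I → QSupAlg Q ar} {m : ∀ i, X → (B i).carrier}

theorem isQOrder_iInf (hm : JointlyInjective m) :
    IsQOrder fun x y => ⨅ i, (B i).e (m i x) (m i y) where
  one_le_refl _ := le_iInf fun i => (B i).isQOrder.one_le_refl _
  trans _ _ _ := le_iInf fun i =>
    (mul_le_mul' (iInf_le _ i) (iInf_le _ i)).trans ((B i).isQOrder.trans _ _ _)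
  antisymm _ _ hxy hyx := hm _ _ fun i =>
    (B i).isQOrder.antisymm _ _ (hxy.trans (iInf_le _ i)) (hyx.trans (iInf_le _ i))

theorem isWeightedJoin_iInf {ι : Type*} {M : ι → Q} {g : ι → X} {s : X}
    (h : ∀ i, IsWeightedJoin (B i).e M (fun k => m i (g k)) (m i s)) :
    IsWeightedJoin (fun x y => ⨅ i, (B i).e (m i x) (m i y)) M g s := by
  intro y q
  simp only [le_iInf_iff]
  rw [forall_comm]
  exact forall_congr' fun i => h i _ q

/-- By `hjoin` some element is a join in every component; it is then a join for the infimum order,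
so it equals `s` by uniqueness. -/
theorem isWeightedJoin_of_iInf (hm : JointlyInjective m)
    (hjoin : ∀ M : X → Q, ∃ s, ∀ i, IsWeightedJoin (B i).e M (m i) (m i s))
    {M : X → Q} {s : X}
    (h : IsWeightedJoin (fun x y => ⨅ i, (B i).e (m i x) (m i y)) M id s) (i : I) :
    IsWeightedJoin (B i).e M (m i) (m i s) := by
  obtain ⟨t, ht⟩ := hjoin M
  rw [h.unique (isQOrder_iInf hm) (isWeightedJoin_iInf (g := id) ht)]
  exact ht i

/-- The initial structure of a `Q`-sup-algebra on a set with a jointly injective family of maps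
to `Q`-sup-algebras along which joins and operations lift. -/
noncomputable def initialStructure (m : ∀ i, X → (B i).carrier) (hm : JointlyInjective m)
    (hjoin : ∀ M : X → Q, ∃ s, ∀ i, IsWeightedJoin (B i).e M (m i) (m i s))
    (hop : ∀ (ω : Ω) (a : Fin (ar ω) → X), ∃ z, ∀ i, m i z = (B i).op ω fun k => m i (a k)) :
    QSupAlg Q ar where
  carrier := X
  e x y := ⨅ i, (B i).e (m i x) (m i y)
  isQOrder := isQOrder_iInf hm
  exists_isQJoin M := by
    obtain ⟨s, hs⟩ := hjoin M
    exact ⟨s, (isQJoin_iff (isQOrder_iInf hm) M s).2 (isWeightedJoin_iInf (g := id) hs)⟩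
  op ω a := (hop ω a).choose
  op_preserving ω j a := by
    rw [isQJoinPreserving_iff (isQOrder_iInf hm) (isQOrder_iInf hm)]
    intro M s hs
    refine isWeightedJoin_iInf fun i => ?_
    have key : ∀ x, m i (hop ω (Function.update a j x)).choose =
        (B i).op ω (Function.update (fun k => m i (a k)) j (m i x)) := by
      intro x
      rw [(hop ω (Function.update a j x)).choose_spec i]
      congr 1
      funext k
      by_cases hk : k = j
      · subst hk; simp
      · simp [hk]
    simp only [key]
    exact (B i).op_isWeightedJoin ω j _ (isWeightedJoin_of_iInf hm hjoin hs i)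

variable (hm : JointlyInjective m)
    (hjoin : ∀ M : X → Q, ∃ s, ∀ i, IsWeightedJoin (B i).e M (m i) (m i s))
    (hop : ∀ (ω : Ω) (a : Fin (ar ω) → X), ∃ z, ∀ i, m i z = (B i).op ω fun k => m i (a k))

/-- The structure maps of the initial structure. -/
noncomputable def initialStructureHom (i : I) : initialStructure m hm hjoin hop ⟶ B i where
  toFun := m i
  preserving := (isQJoinPreserving_iff (isQOrder_iInf hm) (B i).isQOrder).2
    fun _ _ hs => isWeightedJoin_of_iInf hm hjoin hs i
  map_op ω a := ((hop ω a).choose_spec i).symm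

end InitialStructure

/-! ### Images, kernel pairs and regular factorizations -/

section Factorization

variable {I : Type w} {A : QSupAlg Q ar} {B : I → QSupAlg Q ar}

/-- Every source factors as a surjective homomorphism followed by a jointly injective source. -/
theorem exists_surjective_jointlyInjective (f : ∀ i, A ⟶ B i) :
    ∃ (E : QSupAlg Q ar) (e : A ⟶ E) (m : ∀ i, E ⟶ B i), Function.Surjective e.toFun ∧
      JointlyInjective (fun i => (m i).toFun) ∧ ∀ i, e ≫ m i = f i := by
  let r : Setoid A.carrier :=
    { r := fun x y => ∀ i, (f i).toFun x = (f i).toFun y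
      iseqv := ⟨fun _ _ => rfl, fun h i => (h i).symm, fun h h' i => (h i).trans (h' i)⟩ }
  let m : ∀ i, Quotient r → (B i).carrier := fun i => Quotient.lift (f i).toFun fun _ _ h => h i
  have hm : JointlyInjective m := by
    intro x y
    induction x using Quotient.inductionOn
    induction y using Quotient.inductionOn
    exact fun h => Quotient.sound h
  have hjoin : ∀ M : Quotient r → Q, ∃ s, ∀ i, IsWeightedJoin (B i).e M (m i) (m i s) := by
    intro M
    obtain ⟨s, hs⟩ := A.exists_isWeightedJoin (fun a => M (Quotient.mk r a)) id
    refine ⟨Quotient.mk r s, fun i y q => ((f i).isWeightedJoin hs y q).trans ?_⟩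
    exact (Quotient.forall (p := fun x => M x * q ≤ (B i).e (m i x) y)).symm
  have hop : ∀ (ω : Ω) (a : Fin (ar ω) → Quotient r), ∃ z, ∀ i,
      m i z = (B i).op ω fun k => m i (a k) := by
    intro ω a
    -- The choice of representatives is harmless: `m i` of a class does not depend on it.
    refine ⟨Quotient.mk r (A.op ω fun k => (a k).out), fun i => ?_⟩
    refine ((f i).map_op ω _).symm.trans (congrArg _ (funext fun k => ?_))
    conv_rhs => rw [← (a k).out_eq]
    rfl
  refine ⟨initialStructure m hm hjoin hop,
    homOfComp (initialStructureHom hm hjoin hop) hm (Quotient.mk r) f fun _ _ => rfl,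
    initialStructureHom hm hjoin hop, Quotient.mk_surjective, hm, fun _ => rfl⟩

/-- The kernel congruence of a source, as an algebra with two projections. -/
theorem exists_kernelPair (f : ∀ i, A ⟶ B i) :
    ∃ (K : QSupAlg Q ar) (p q : K ⟶ A), (∀ i, p ≫ f i = q ≫ f i) ∧
      ∀ x y, (∀ i, (f i).toFun x = (f i).toFun y) → ∃ z, p.toFun z = x ∧ q.toFun z = y := by
  let X := {z : A.carrier × A.carrier // ∀ i, (f i).toFun z.1 = (f i).toFun z.2}
  let m : Bool → X → A.carrier := fun b z => cond b z.1.1 z.1.2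
  have hm : JointlyInjective m := fun x y h =>
    Subtype.ext (Prod.ext (h true) (h false))
  have hjoin : ∀ M : X → Q, ∃ s, ∀ i, IsWeightedJoin A.e M (m i) (m i s) := by
    intro M
    choose s hs using fun b => A.exists_isWeightedJoin M (m b)
    -- The componentwise join stays in the kernel: `f i` sends its two components to joins of the
    -- same family.
    refine ⟨⟨(s true, s false), fun i => ?_⟩, fun b => ?_⟩
    · have h1 := (f i).isWeightedJoin (hs true)
      have h2 := (f i).isWeightedJoin (hs false)
      have h3 : (fun z => (f i).toFun (m true z)) = fun z => (f i).toFun (m false z) :=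
        funext fun z => z.2 i
      rw [h3] at h1
      exact h1.unique (B i).isQOrder h2
    · cases b
      exacts [hs false, hs true]
  have hop : ∀ (ω : Ω) (a : Fin (ar ω) → X), ∃ z, ∀ i, m i z = A.op ω fun k => m i (a k) := by
    intro ω a
    refine ⟨⟨(A.op ω fun k => m true (a k), A.op ω fun k => m false (a k)), fun i => ?_⟩,
      fun b => ?_⟩
    · simp only [← (f i).map_op]
      exact congrArg _ (funext fun k => (a k).2 i)
    · cases b <;> rfl
  refine ⟨initialStructure (B := fun _ : Bool => A) m hm hjoin hop,
    initialStructureHom (B := fun _ : Bool => A) hm hjoin hop true,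
    initialStructureHom (B := fun _ : Bool => A) hm hjoin hop false,
    fun i => hom_ext fun z => z.2 i, fun x y h => ⟨⟨(x, y), h⟩, rfl, rfl⟩⟩

/-- A mono-source cannot separate the two projections of its kernel congruence, so that congruence
is the diagonal. -/
theorem isMonoSource_iff (f : ∀ i, A ⟶ B i) :
    IsMonoSource f ↔ JointlyInjective fun i => (f i).toFun := by
  constructor
  · intro hf x y hxy
    obtain ⟨K, p, q, hpq, h⟩ := exists_kernelPair f
    obtain ⟨z, rfl, rfl⟩ := h x y hxy
    rw [hf p q hpq]
  · intro hf Z g h hgh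
    exact hom_ext fun z => hf _ _ fun i => toFun_congr (hgh i) z

theorem mono_iff_injective {A B : QSupAlg Q ar} (f : A ⟶ B) :
    Mono f ↔ Function.Injective f.toFun := by
  have h1 : Mono f ↔ IsMonoSource fun _ : Unit => f :=
    ⟨fun h _ _ _ hgh => h.right_cancellation _ _ (hgh ()),
      fun h => ⟨fun _ _ hgh => h _ _ fun _ => hgh⟩⟩
  rw [h1, isMonoSource_iff]
  exact ⟨fun h x y hxy => h x y fun _ => hxy, fun h x y hxy => h (hxy ())⟩

theorem surjective_of_isIso {A B : QSupAlg Q ar} (f : A ⟶ B) [IsIso f] :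
    Function.Surjective f.toFun :=
  fun b => ⟨(inv f).toFun b, toFun_congr (IsIso.inv_hom_id f) b⟩

theorem surjective_of_extremalEpi {A B : QSupAlg Q ar} (f : A ⟶ B) [ExtremalEpi f] :
    Function.Surjective f.toFun := by
  obtain ⟨E, e, m, he, hm, hem⟩ := exists_surjective_jointlyInjective fun _ : Unit => f
  have := (mono_iff_injective (m ())).2 fun x y h => hm _ _ fun _ => h
  have := ExtremalEpi.isIso f e (m ()) (hem ())
  rw [← hem ()]
  exact (surjective_of_isIso (m ())).comp he

/-- Regular epimorphisms are extremal, hence surjective. Conversely, finality makes a surjection the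
coequalizer of its kernel pair. -/
theorem isRegularEpi_iff_surjective {A B : QSupAlg Q ar} (f : A ⟶ B) :
    IsRegularEpi f ↔ Function.Surjective f.toFun := by
  refine ⟨fun _ => surjective_of_extremalEpi f, fun hf => ?_⟩
  obtain ⟨K, p, q, hpq, h⟩ := exists_kernelPair fun _ : Unit => f
  have hepi : Epi f := ⟨fun g k hgk => hom_ext fun b => by
    obtain ⟨a, rfl⟩ := hf b
    exact toFun_congr hgk a⟩
  have hdesc : ∀ {D : QSupAlg Q ar} (k : A ⟶ D), p ≫ k = q ≫ k → ∃ d : B ⟶ D, f ≫ d = k := by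
    intro D k hk
    refine exists_comp_eq_of_surjective f hf k fun x y hxy => ?_
    obtain ⟨z, rfl, rfl⟩ := h x y fun _ => hxy
    exact toFun_congr hk z
  exact ⟨⟨{ W := K, left := p, right := q, w := hpq ()
            isColimit := Cofork.IsColimit.mk _ (fun s => (hdesc s.π s.condition).choose)
              (fun s => (hdesc s.π s.condition).choose_spec)
              fun s d hd => hepi.left_cancellation _ _
                (hd.trans (hdesc s.π s.condition).choose_spec.symm) }⟩⟩

theorem hasRegularFactorizations : HasRegularFactorizations.{w} (QSupAlg Q ar) where
  regularEpi_comp_iso e h he := by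
    rw [isRegularEpi_iff_surjective] at he ⊢
    exact (surjective_of_isIso h.hom).comp he
  iso_comp_monoSource h m hm Z g k hgk := by
    rw [← cancel_mono h.hom]
    exact hm _ _ fun i => by simpa using hgk i
  factorization f := by
    obtain ⟨E, e, m, he, hm, hem⟩ := exists_surjective_jointlyInjective f
    exact ⟨E, e, m, (isRegularEpi_iff_surjective e).2 he, (isMonoSource_iff m).2 hm, hem⟩
  diagonalization e m f g he hm hsq := by
    rw [isRegularEpi_iff_surjective] at he
    have hm' := (isMonoSource_iff m).1 hm
    have hcancel : ∀ {Z : QSupAlg Q ar} (d d' : _ ⟶ Z), e ≫ d = e ≫ d' → d = d' :=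
      fun d d' h => hom_ext fun b => by
        obtain ⟨a, rfl⟩ := he b
        exact toFun_congr h a
    obtain ⟨d, hd⟩ := exists_comp_eq_of_surjective e he f fun x y hxy => hm' _ _ fun i => by
      have h1 := toFun_congr (hsq i) x
      have h2 := toFun_congr (hsq i) y
      simp only [comp_toFun] at h1 h2
      beta_reduce
      rw [← h1, ← h2, hxy]
    refine ⟨d, ⟨hd, fun i => hcancel _ _ ?_⟩, fun d' hd' => hcancel _ _ (hd'.1.trans hd.symm)⟩
    rw [← Category.assoc, hd, hsq]

end Factorization

/-! ### Smallness of subobjects and extremal quotients -/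

theorem wellPowered : WellPowered.{u} (QSupAlg Q ar) where
  subobject_small A := by
    let φ : Subobject A → Set A.carrier := fun P => Set.range P.arrow.toFun
    have key : ∀ P P' : Subobject A, φ P ⊆ φ P' → P ≤ P' := by
      intro P P' h
      have hinj := (mono_iff_injective P'.arrow).1 inferInstance
      choose d hd using fun x => h (Set.mem_range_self x)
      exact Subobject.le_of_comm (homOfComp (fun _ : Unit => P'.arrow)
        (fun x y hxy => hinj (hxy ())) d (fun _ => P.arrow) fun _ => hd) (hom_ext hd)
    exact small_of_injective (f := φ) fun P P' h =>
      le_antisymm (key P P' h.le) (key P' P h.ge)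

theorem extremallyCoWellPowered : ExtremallyCoWellPowered (QSupAlg Q ar) := by
  intro A
  let φ : {S : Subobject (Opposite.op A) // ExtremalEpi S.arrow.unop} → Set (A.carrier × A.carrier) :=
    fun S => {z | S.1.arrow.unop.toFun z.1 = S.1.arrow.unop.toFun z.2}
  -- A larger kernel means a further quotient, which is a smaller subobject in the opposite
  -- category.
  have key : ∀ S S', φ S ⊆ φ S' → S'.1 ≤ S.1 := by
    intro S S' h
    have := S.2
    obtain ⟨d, hd⟩ := exists_comp_eq_of_surjective S.1.arrow.unop
      (surjective_of_extremalEpi _) S'.1.arrow.unop fun x y hxy => @h (x, y) hxy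
    exact Subobject.le_of_comm d.op (Quiver.Hom.unop_inj hd)
  exact small_of_injective (f := φ) fun S S' h =>
    Subtype.ext (le_antisymm (key S' S h.ge) (key S S' h.le))

/-! ### Limits -/

section Limits

variable {J : Type u} [Category.{u} J] (F : J ⥤ QSupAlg Q ar)

theorem hasLimit : HasLimit F := by
  let X := {x : ∀ j, (F.obj j).carrier // ∀ ⦃j k⦄ (f : j ⟶ k), (F.map f).toFun (x j) = x k}
  let m : ∀ j, X → (F.obj j).carrier := fun j x => x.1 j
  have hm : JointlyInjective m := fun x y h => Subtype.ext (funext h)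
  have hjoin : ∀ M : X → Q, ∃ s, ∀ j, IsWeightedJoin (F.obj j).e M (m j) (m j s) := by
    intro M
    choose s hs using fun j => (F.obj j).exists_isWeightedJoin M (m j)
    -- Componentwise joins form a compatible family because the transition maps preserve joins.
    refine ⟨⟨s, fun j k f => ?_⟩, hs⟩
    have h1 := (F.map f).isWeightedJoin (hs j)
    have h2 : (fun x => (F.map f).toFun (m j x)) = m k := funext fun x => x.2 f
    rw [h2] at h1
    exact h1.unique (F.obj k).isQOrder (hs k)
  have hop : ∀ (ω : Ω) (a : Fin (ar ω) → X), ∃ z, ∀ j,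
      m j z = (F.obj j).op ω fun i => m j (a i) := by
    intro ω a
    refine ⟨⟨fun j => (F.obj j).op ω fun i => m j (a i), fun j k f => ?_⟩, fun _ => rfl⟩
    rw [← (F.map f).map_op]
    exact congrArg _ (funext fun i => (a i).2 f)
  let π := initialStructureHom hm hjoin hop
  let c : Cone F :=
    { pt := initialStructure m hm hjoin hop
      π := { app := π
             naturality := fun j k f => by
               exact hom_ext fun x => (x.2 f).symm } }
  have hc : IsLimit c :=
    { lift := fun s => homOfComp π hm
        (fun z => ⟨fun j => (s.π.app j).toFun z, fun j k f => toFun_congr (s.w f) z⟩)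
        s.π.app fun _ _ => rfl
      fac := fun s j => rfl
      uniq := fun s d hd => hom_ext fun z => hm _ _ fun j => toFun_congr (hd j) z }
  exact ⟨⟨⟨c, hc⟩⟩⟩

theorem hasLimits : HasLimits (QSupAlg Q ar) := ⟨fun _ _ => ⟨fun F => hasLimit F⟩⟩

end Limits

end QSupAlg

/-! ### Free algebras and colimits -/

namespace QSupAlg

/-- Terms of the type `Ω` with arities `ar` in variables from `Y`. -/
inductive Term {Ω : Type u} (ar : Ω → ℕ) (Y : Type u) : Type u
  | var (y : Y) : Term ar Y
  | app (ω : Ω) (a : Fin (ar ω) → Term ar Y) : Term ar Y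

theorem prod_update_apply {R : Type*} [CommMonoid R] {n : ℕ} {T : Type*} (j : Fin n) (a : Fin n → T → R) (x : T → R)
    (b : Fin n → T) : ∏ i, Function.update a j x i (b i) =
      x (b j) * ∏ i ∈ Finset.univ.erase j, a i (b i) := by
  rw [← Finset.mul_prod_erase _ _ (Finset.mem_univ j), Function.update_self]
  congr 1
  refine Finset.prod_congr rfl fun i hi => ?_
  rw [Function.update_of_ne (Finset.ne_of_mem_erase hi)]

variable {Q : Type u} [CommMonoid Q] [CompleteLattice Q]
  {Ω : Type u} {ar : Ω → ℕ} {Y : Type u}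

/-- The convolution operations on `Q`-valued functions on terms. -/
def convolve (ω : Ω) (a : Fin (ar ω) → Term ar Y → Q) (t : Term ar Y) : Q :=
  ⨆ b : {b : Fin (ar ω) → Term ar Y // Term.app ω b = t}, ∏ i, a i (b.1 i)

/-- The indicator function of a term. -/
def indicator (Q : Type u) [CommMonoid Q] [CompleteLattice Q] (s t : Term ar Y) : Q :=
  ⨆ _ : s = t, 1

theorem indicator_self (t : Term ar Y) : indicator Q t t = 1 := by simp [indicator]

theorem indicator_of_ne {s t : Term ar Y} (h : s ≠ t) : indicator Q s t = ⊥ := by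
  simp [indicator, h]

variable [IsQuantale Q]

theorem iSup_mul_indicator (M : Term ar Y → Q) (t : Term ar Y) :
    ⨆ s, M s * indicator Q s t = M t := by
  apply le_antisymm
  · refine iSup_le fun s => ?_
    by_cases h : s = t
    · rw [h, indicator_self, mul_one]
    · rw [indicator_of_ne h, Quantale.mul_bot]
      exact bot_le
  · exact le_iSup_of_le t (by rw [indicator_self, mul_one])

theorem isWeightedJoin_indicator {X : Type v} {e : X → X → Q} (g : Term ar Y → X)
    (t : Term ar Y) : IsWeightedJoin e (indicator Q t) g (g t) := by
  refine fun y q => ⟨fun hq s => ?_, fun hq => ?_⟩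
  · by_cases h : t = s
    · subst h
      rwa [indicator_self, one_mul]
    · rw [indicator_of_ne h, Quantale.bot_mul]
      exact bot_le
  · simpa [indicator_self] using hq t

/-- A product with one factor `⊥` is `⊥`, so only the tuple `b` itself contributes. -/
theorem convolve_indicator (ω : Ω) (b : Fin (ar ω) → Term ar Y) :
    convolve ω (fun i => indicator Q (b i)) = indicator Q (Term.app ω b) := by
  funext t
  apply le_antisymm
  · refine iSup_le fun ⟨c, hc⟩ => ?_
    beta_reduce
    by_cases h : b = c
    · subst h hc
      simp [indicator_self]
    · obtain ⟨i, hi⟩ := Function.ne_iff.1 h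
      rw [← Finset.mul_prod_erase _ _ (Finset.mem_univ i), indicator_of_ne hi, Quantale.bot_mul]
      exact bot_le
  · refine iSup_le fun h => ?_
    exact le_iSup_of_le ⟨b, h⟩ (by simp [indicator_self])

/-- Each product contains its `j`-th factor exactly once, so multiplication distributes over the
join and the two joins can be exchanged. -/
theorem convolve_update_iSup {ι : Type*} (ω : Ω) (j : Fin (ar ω))
    (a : Fin (ar ω) → Term ar Y → Q) (M : ι → Q) (g : ι → Term ar Y → Q) :
    convolve ω (Function.update a j fun t => ⨆ k, M k * g k t) =
      fun t => ⨆ k, M k * convolve ω (Function.update a j (g k)) t := by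
  funext t
  simp only [convolve, prod_update_apply, Quantale.iSup_mul_distrib, Quantale.mul_iSup_distrib,
    mul_assoc]
  exact iSup_comm

/-- The pointwise `Q`-order on `Q`-valued functions. -/
def pointwiseOrder {T : Type v} (M N : T → Q) : Q := ⨅ t, (M t ⇨ᵣ N t)

theorem le_pointwiseOrder_iff {T : Type v} {M N : T → Q} {q : Q} :
    q ≤ pointwiseOrder M N ↔ ∀ t, M t * q ≤ N t := by
  simp only [pointwiseOrder, le_iInf_iff, Quantale.rightMulResiduation_le_iff_mul_le]

theorem isQOrder_pointwiseOrder {T : Type v} :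
    IsQOrder (pointwiseOrder : (T → Q) → (T → Q) → Q) where
  one_le_refl M := le_pointwiseOrder_iff.2 fun t => by rw [mul_one]
  trans L M N := le_pointwiseOrder_iff.2 fun t => by
    rw [← mul_assoc]
    exact (mul_le_mul_left (le_pointwiseOrder_iff.1 le_rfl t) _).trans
      (le_pointwiseOrder_iff.1 le_rfl t)
  antisymm M N h h' := funext fun t => le_antisymm
    (by simpa using le_pointwiseOrder_iff.1 h t) (by simpa using le_pointwiseOrder_iff.1 h' t)

theorem isWeightedJoin_pointwiseOrder {ι : Type*} {T : Type v} (M : ι → Q) (g : ι → T → Q) :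
    IsWeightedJoin pointwiseOrder M g fun t => ⨆ k, M k * g k t := by
  intro y q
  simp only [le_pointwiseOrder_iff, Quantale.iSup_mul_distrib, iSup_le_iff]
  rw [forall_comm]
  refine forall₂_congr fun k t => ?_
  rw [mul_left_comm, mul_assoc]

theorem isWeightedJoin_pointwiseOrder_iff {ι : Type*} {T : Type v} {M : ι → Q} {g : ι → T → Q}
    {s : T → Q} : IsWeightedJoin pointwiseOrder M g s ↔ s = fun t => ⨆ k, M k * g k t :=
  ⟨fun h => h.unique isQOrder_pointwiseOrder (isWeightedJoin_pointwiseOrder M g),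
    fun h => h ▸ isWeightedJoin_pointwiseOrder M g⟩

variable (Q ar Y) in
/-- The free `Q`-sup-algebra on a set `Y`. -/
def free : QSupAlg Q ar where
  carrier := Term ar Y → Q
  e := pointwiseOrder
  isQOrder := isQOrder_pointwiseOrder
  exists_isQJoin M :=
    ⟨_, (isQJoin_iff isQOrder_pointwiseOrder _ _).2 (isWeightedJoin_pointwiseOrder M id)⟩
  op := convolve
  op_preserving ω j a := by
    rw [isQJoinPreserving_iff isQOrder_pointwiseOrder isQOrder_pointwiseOrder]
    intro M s hs
    rw [isWeightedJoin_pointwiseOrder_iff] at hs ⊢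
    rw [hs]
    exact convolve_update_iSup ω j a M id

/-- The element of the free algebra given by a term. -/
def ofTerm (Q : Type u) [CommMonoid Q] [CompleteLattice Q] [IsQuantale Q] (t : Term ar Y) :
    (free Q ar Y).carrier :=
  indicator Q t

/-- Density of terms: a join-preserving map out of the free algebra is determined by its values on
them. -/
theorem free_isWeightedJoin_ofTerm (M : (free Q ar Y).carrier) :
    IsWeightedJoin (free Q ar Y).e (ι := Term ar Y) M (ofTerm Q) M :=
  isWeightedJoin_pointwiseOrder_iff.2 (funext fun t => (iSup_mul_indicator M t).symm)

theorem free_op_ofTerm (ω : Ω) (b : Fin (ar ω) → Term ar Y) :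
    (free Q ar Y).op ω (fun i => ofTerm Q (b i)) = ofTerm Q (Term.app ω b) :=
  convolve_indicator ω b

/-- Separately join-preserving maps out of a power of a free algebra agree if they agree on
tuples of terms. -/
theorem eq_of_forall_ofTerm {n : ℕ} {A : QSupAlg Q ar}
    {φ ψ : (Fin n → (free Q ar Y).carrier) → A.carrier}
    (hφ : ∀ j a, IsQJoinPreserving (free Q ar Y).e A.e fun x => φ (Function.update a j x))
    (hψ : ∀ j a, IsQJoinPreserving (free Q ar Y).e A.e fun x => ψ (Function.update a j x))
    (h : ∀ b : Fin n → Term ar Y,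
      φ (fun i => ofTerm Q (b i)) = ψ (fun i => ofTerm Q (b i))) : φ = ψ := by
  -- Induction on a set `s` of coordinates outside which all entries are terms.
  have key : ∀ (s : Finset (Fin n)) (a : Fin n → (free Q ar Y).carrier),
      (∀ i ∉ s, ∃ t, ofTerm Q t = a i) → φ a = ψ a := by
    intro s
    induction s using Finset.induction_on with
    | empty =>
      intro a ha
      choose b hb using fun i => ha i (Finset.notMem_empty i)
      have : a = fun i => ofTerm Q (b i) := funext fun i => (hb i).symm
      rw [this, h]
    | insert j s _ ih =>
      intro a ha
      -- Expand the `j`-th entry as a join of terms; the induction hypothesis then compares the two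
      -- joins termwise.
      have h1 := (hφ j a).isWeightedJoin (free Q ar Y).isQOrder A.isQOrder
        (free_isWeightedJoin_ofTerm (a j))
      have h2 := (hψ j a).isWeightedJoin (free Q ar Y).isQOrder A.isQOrder
        (free_isWeightedJoin_ofTerm (a j))
      have h3 : ∀ t, φ (Function.update a j (ofTerm Q t)) =
          ψ (Function.update a j (ofTerm Q t)) := by
        refine fun t => ih _ fun i hi => ?_
        by_cases hij : i = j
        · subst hij
          exact ⟨t, by rw [Function.update_self]⟩
        · rw [Function.update_of_ne hij]
          exact ha i (by simp [hij, hi])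
      simp only [Function.update_eq_self, h3] at h1 h2
      exact h1.unique A.isQOrder h2
  exact funext fun a => key Finset.univ a fun i hi => absurd (Finset.mem_univ i) hi

/-- Evaluation of terms. -/
def Term.eval (A : QSupAlg Q ar) (g : Y → A.carrier) : Term ar Y → A.carrier
  | var y => g y
  | app ω a => A.op ω fun i => (a i).eval A g

/-- The extension sends `M` to the join of `g` weighted by `M`. -/
theorem exists_isQJoinPreserving_free (A : QSupAlg Q ar) (g : Term ar Y → A.carrier) :
    ∃ f : (free Q ar Y).carrier → A.carrier, IsQJoinPreserving (free Q ar Y).e A.e f ∧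
      ∀ t, f (ofTerm Q t) = g t := by
  choose f hf using fun M : (free Q ar Y).carrier => A.exists_isWeightedJoin (ι := Term ar Y) M g
  refine ⟨f, ?_, fun t => ?_⟩
  · rw [isQJoinPreserving_iff (free Q ar Y).isQOrder A.isQOrder]
    intro M s hs
    have hs' := isWeightedJoin_pointwiseOrder_iff.1 hs
    intro y q
    rw [hf, hs']
    simp only [Quantale.iSup_mul_distrib, iSup_le_iff]
    rw [forall_comm]
    refine forall_congr' fun N => ?_
    rw [hf]
    refine forall_congr' fun t => ?_
    rw [mul_left_comm, mul_assoc]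
    rfl
  · exact (hf _).unique A.isQOrder (isWeightedJoin_indicator g t)

theorem exists_free_lift (A : QSupAlg Q ar) (g : Y → A.carrier) :
    ∃ f : free Q ar Y ⟶ A, ∀ y, f.toFun (ofTerm Q (Term.var y)) = g y := by
  obtain ⟨f, hf, hfg⟩ := exists_isQJoinPreserving_free A (Term.eval A g)
  refine ⟨⟨f, hf, fun ω a => ?_⟩, fun y => hfg _⟩
  -- Both sides preserve joins in each argument, so it suffices to compare them on terms, where
  -- evaluation commutes with operations by definition.
  refine congrFun (eq_of_forall_ofTerm (φ := fun a => A.op ω fun i => f (a i))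
    (ψ := fun a => f ((free Q ar Y).op ω a)) (fun j a => ?_) (fun j a => ?_) fun b => ?_) a
  · have h1 : ∀ x, (fun i => f (Function.update a j x i)) =
        Function.update (fun i => f (a i)) j (f x) :=
      fun x => (Function.comp_update f a j x)
    simp only [h1]
    rw [isQJoinPreserving_iff (free Q ar Y).isQOrder A.isQOrder]
    exact fun M s hs => A.op_isWeightedJoin ω j _
      (hf.isWeightedJoin (free Q ar Y).isQOrder A.isQOrder hs)
  · rw [isQJoinPreserving_iff (free Q ar Y).isQOrder A.isQOrder]
    exact fun M s hs => hf.isWeightedJoin (free Q ar Y).isQOrder A.isQOrder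
      ((free Q ar Y).op_isWeightedJoin ω j a hs)
  · rw [free_op_ofTerm, hfg]
    simp only [hfg]
    rfl

theorem free_hom_ext {A : QSupAlg Q ar} {f g : free Q ar Y ⟶ A}
    (h : ∀ y, f.toFun (ofTerm Q (Term.var y)) = g.toFun (ofTerm Q (Term.var y))) :
    f = g := by
  have key : ∀ t, f.toFun (ofTerm Q t) = g.toFun (ofTerm Q t) := by
    intro t
    induction t with
    | var y => exact h y
    | app ω a ih =>
      rw [← free_op_ofTerm, ← f.map_op, ← g.map_op]
      simp only [ih]
  refine hom_ext fun M => ?_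
  have h1 := f.isWeightedJoin (free_isWeightedJoin_ofTerm M)
  have h2 := g.isWeightedJoin (free_isWeightedJoin_ofTerm M)
  simp only [key] at h1
  exact h1.unique A.isQOrder h2

theorem hasColimit {J : Type u} [Category.{u} J] (F : J ⥤ QSupAlg Q ar) : HasColimit F := by
  choose f hf using fun c : Cocone F =>
    exists_free_lift c.pt fun y : Σ j, (F.obj j).carrier => (c.ι.app y.1).toFun y.2
  obtain ⟨E, e, m, he, hm, hem⟩ := exists_surjective_jointlyInjective f
  have hme : ∀ c j x, (m c).toFun (e.toFun (ofTerm Q (Term.var ⟨j, x⟩))) =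
      (c.ι.app j).toFun x :=
    fun c j x => (toFun_congr (hem c) _).trans (hf c ⟨j, x⟩)
  -- Sending elements to generators is not a homomorphism into the free algebra, but becomes one in
  -- `E`: its composite with each `m c` is the leg of `c`.
  let ι : ∀ j, F.obj j ⟶ E := fun j =>
    homOfComp m hm (fun x => e.toFun (ofTerm Q (Term.var ⟨j, x⟩))) (fun c => c.ι.app j)
      fun c x => hme c j x
  let c : Cocone F :=
    { pt := E
      ι := { app := ι
             naturality := fun j k φ => hom_ext fun x => hm _ _ fun c =>
               (hme c k _).trans ((toFun_congr (c.w φ) x).trans (hme c j x).symm) } }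
  have hc : IsColimit c :=
    { desc := fun s => m s
      fac := fun s j => hom_ext fun x => hme s j x
      uniq := fun s d hd => by
        -- The cocone condition fixes `d` on the images of the generators, and `e` is surjective.
        have : e ≫ d = e ≫ m s := free_hom_ext fun ⟨j, x⟩ =>
          (toFun_congr (hd j) x).trans (hme s j x).symm
        refine hom_ext fun b => ?_
        obtain ⟨a, rfl⟩ := he b
        exact toFun_congr this a }
  exact ⟨⟨⟨c, hc⟩⟩⟩

theorem hasColimits : HasColimits (QSupAlg Q ar) := ⟨fun _ _ => ⟨fun F => hasColimit F⟩⟩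

end QSupAlg

theorem mainTheorem6 (Q : Type u) [CommMonoid Q] [CompleteLattice Q] [IsQuantale Q]
    {Ω : Type u} (ar : Ω → ℕ) :
    HasLimits (QSupAlg Q ar) ∧
    HasColimits (QSupAlg Q ar) ∧
    WellPowered.{u} (QSupAlg Q ar) ∧
    ExtremallyCoWellPowered (QSupAlg Q ar) ∧
    HasRegularFactorizations.{w} (QSupAlg Q ar) ∧
    ∀ {A B : QSupAlg Q ar} (f : A ⟶ B), Mono f ↔ Function.Injective f.toFun :=
  ⟨QSupAlg.hasLimits, QSupAlg.hasColimits, QSupAlg.wellPowered, QSupAlg.extremallyCoWellPowered,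
    QSupAlg.hasRegularFactorizations, QSupAlg.mono_iff_injective⟩
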